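/- Let $\alpha > -1/2$ and $1<p<q<\infty$, and let $\sigma$ be determined by $$\frac1q=\frac1p-\frac{\sigma}{\alpha+1}.$$ Put $d\mu_\alpha(x)=x^{2\alpha+1}\,dx$ on $(0,\infty)$ and $$d\nu_\alpha(\theta)=\frac{\Gamma(\alpha+1)}{\pi^{1/2}\,\Gamma(\alpha+1/2)}(\sin\theta)^{2\alpha}\,d\theta \quad\text{on }(0,\pi),\qquad (x,y)_\theta=(x^2+y^2-2xy\cos\theta)^{1/2}.$$ For functions $F,G$ on $(0,\infty)$ define the generalized Euclidean translation and convolution by $$\tau^E_xF(y)=\int_0^\pi F((x,y)_\theta)\,d\nu_\alpha(\theta),\qquad F*G(x)=\int_0^\infty \tau^E_xF(y)\,G(y)\,d\mu_\alpha(y),$$ and let $K_\sigma(x)=x^{2(\sigma-\alpha-1)}$ for $x>0$. Then there is a constant $C$, depending only on $\alpha,p,q$, such that for every complex-valued $F\in L^p((0,\infty),d\mu_\alpha)$ the following holds: for almost every $x>0$ the integrals defining $F*K_\sigma(x)$ converge absolutely (that is, the integral defining $\tau^E_xF(y)$ converges absolutely for almost every $y>0$, and so does the integral over $y$), the function $F*K_\sigma$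 belongs to $L^q((0,\infty),d\mu_\alpha)$, and $$\|F*K_\sigma\|_{L^q(d\mu_\alpha)}\le C\,\|F\|_{L^p(d\mu_\alpha)}.$$ -/

import Mathlib

open MeasureTheory
open scoped NNReal ENNReal

noncomputable section

namespace Hankel

/-- The measure `dμ_α(x) = x^{2α+1} dx` on the half-line `(0, ∞)`, as a measure on `ℝ` which does
not charge `(-∞, 0]`. -/
def mu (α : ℝ) : Measure ℝ :=
  (volume.restrict (Set.Ioi 0)).withDensity fun x => ENNReal.ofReal (x ^ (2 * α + 1))

/-- The measure `dν_α(θ) = Γ(α+1) / (π^{1/2} Γ(α+1/2)) (sin θ)^{2α} dθ` on `(0, π)`. -/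
def nu (α : ℝ) : Measure ℝ :=
  (volume.restrict (Set.Ioo 0 Real.pi)).withDensity fun θ =>
    ENNReal.ofReal
      (Real.Gamma (α + 1) / (Real.pi ^ (1 / 2 : ℝ) * Real.Gamma (α + 1 / 2)) *
        Real.sin θ ^ (2 * α))

/-- `(x, y)_θ = (x² + y² - 2xy cos θ)^{1/2}`. -/
def side (x y θ : ℝ) : ℝ :=
  Real.sqrt (x ^ 2 + y ^ 2 - 2 * x * y * Real.cos θ)

/-- The generalized Euclidean translation `τ^E_x F(y) = ∫_0^π F((x, y)_θ) dν_α(θ)`. -/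
def translation (α : ℝ) (x : ℝ) (F : ℝ → ℂ) (y : ℝ) : ℂ :=
  ∫ θ, F (side x y θ) ∂(nu α)

/-- The generalized Euclidean convolution `F * G(x) = ∫_0^∞ τ^E_x F(y) G(y) dμ_α(y)`. -/
def conv (α : ℝ) (F G : ℝ → ℂ) (x : ℝ) : ℂ :=
  ∫ y, translation α x F y * G y ∂(mu α)

/-- The integrals defining `F * G` at the point `x` exist: the one defining `τ^E_x F(y)` converges
absolutely for almost every `y`, and so does the outer one. -/
def ConvExistsAt (α : ℝ) (F G : ℝ → ℂ) (x : ℝ) : Prop :=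
  (∀ᵐ y ∂(mu α), Integrable (fun θ => F (side x y θ)) (nu α)) ∧
    Integrable (fun y => translation α x F y * G y) (mu α)

/-- The kernel `K_σ(x) = x^{2(σ-α-1)}`, `x > 0`. -/
def kernel (α σ : ℝ) (x : ℝ) : ℂ :=
  ((x ^ (2 * (σ - α - 1)) : ℝ) : ℂ)

end Hankel

end

/-! By symmetry of the translation, `F * K_σ(x)` is the integral of `F` against the translated
kernel `τ_x K_σ`. Write `K_σ(y) = y^{-d}` with `d = (2α+2)/r` and `1/p + 1/r = 1 + 1/q`. In the
variables `x = e^t`, `y = e^s` homogeneity turns the operator into an ordinary convolution on `ℝ`,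
with kernel `e^{κu} logKernel α d u`, `κ = d/2 - (2α+2)/q`.

Although `K_σ` is only in weak `L^r(μ_α)`, this new kernel is in `L^r(ℝ)`: averaging over `θ`
softens the singularity at `u = 0` (as `α > -1/2`), and the decay `e^{-d|u|/2}` beats `e^{κu}`.
Young's inequality then gives the strong bound, without interpolation. The carriers are
`lintegral_mu_nu_swap`, `side_exp`, `lintegral_logKernel_rpow_lt_top` and `lintegral_conv_rpow_le`.
-/

/-! ### Young's inequality and the exponential substitution. -/

/-- Young's inequality `L^p * L^r → L^q` on the real line, for `ℝ≥0∞`-valued functions. -/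
theorem lintegral_conv_rpow_le {p q r : ℝ} (hp : 1 < p) (hpq : p < q) (hr : 0 < r)
    (hpqr : 1 / p + 1 / r = 1 + 1 / q) {f h : ℝ → ℝ≥0∞} (hf : Measurable f) (hh : Measurable h) :
    ∫⁻ t, (∫⁻ s, h (s - t) * f s) ^ q ≤
      (∫⁻ s, h s ^ r) ^ (q / r) * (∫⁻ s, f s ^ p) ^ (q / p) := by
  have hp0 : 0 < p := by linarith
  have hq0 : 0 < q := by linarith
  have hqp : 0 < 1 / p - 1 / q := sub_pos.2 (one_div_lt_one_div_of_lt hp0 hpq)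
  have hqr : 0 < 1 / r - 1 / q := by
    have : 1 / p < 1 := by rw [div_lt_one hp0]; exact hp
    linarith
  have hq1 : 0 < 1 / q := by positivity
  set A := ∫⁻ s, h s ^ r with hA
  set B := ∫⁻ s, f s ^ p with hB
  have hshift : ∀ t, ∫⁻ s, h (s - t) ^ r = A := fun t =>
    lintegral_sub_right_eq_self (fun s => h s ^ r) t
  have hrefl : ∀ s, ∫⁻ t, h (s - t) ^ r = A := fun s =>
    lintegral_sub_left_eq_self (fun s => h s ^ r) s
  have hmeas : Measurable fun z : ℝ × ℝ => h (z.2 - z.1) ^ r * f z.2 ^ p := by fun_prop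
  -- Hölder with weights `1/q`, `1/p - 1/q`, `1/r - 1/q` (sum 1) applied to `h^r f^p`, `f^p`, `h^r`.
  -- Only the first factor still depends on `t` after integration, and Tonelli handles its `q`-th
  -- power.
  have hpt : ∀ t, ∫⁻ s, h (s - t) * f s ≤
      (∫⁻ s, h (s - t) ^ r * f s ^ p) ^ (1 / q) * (B ^ (1 / p - 1 / q) * A ^ (1 / r - 1 / q)) := by
    intro t
    have key := ENNReal.lintegral_prod_norm_pow_le (μ := (volume : Measure ℝ)) Finset.univ
      (f := ![fun s => h (s - t) ^ r * f s ^ p, fun s => f s ^ p, fun s => h (s - t) ^ r])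
      (p := ![1 / q, 1 / p - 1 / q, 1 / r - 1 / q])
      (by
        intro i _
        fin_cases i
        · exact (by fun_prop : Measurable fun s => h (s - t) ^ r * f s ^ p).aemeasurable
        · exact (by fun_prop : Measurable fun s => f s ^ p).aemeasurable
        · exact (by fun_prop : Measurable fun s => h (s - t) ^ r).aemeasurable)
      (by simp [Fin.sum_univ_three] at hpqr ⊢; linarith)
      (by
        intro i _
        fin_cases i
        · exact hq1.le
        · exact hqp.le
        · exact hqr.le)
    simp only [Fin.prod_univ_three] at key
    change ∫⁻ s, (h (s - t) ^ r * f s ^ p) ^ (1 / q) * (f s ^ p) ^ (1 / p - 1 / q) *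
      (h (s - t) ^ r) ^ (1 / r - 1 / q) ≤ (∫⁻ s, h (s - t) ^ r * f s ^ p) ^ (1 / q) *
      B ^ (1 / p - 1 / q) * (∫⁻ s, h (s - t) ^ r) ^ (1 / r - 1 / q) at key
    rw [hshift, mul_assoc] at key
    refine le_trans (lintegral_mono fun s => le_of_eq ?_) key
    rw [ENNReal.mul_rpow_of_nonneg _ _ hq1.le, ← ENNReal.rpow_mul, ← ENNReal.rpow_mul,
      ← ENNReal.rpow_mul, ← ENNReal.rpow_mul]
    have e1 : h (s - t) = h (s - t) ^ (r * (1 / q)) * h (s - t) ^ (r * (1 / r - 1 / q)) := by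
      rw [← ENNReal.rpow_add_of_nonneg _ _ (by positivity) (by positivity)]
      have : r * (1 / q) + r * (1 / r - 1 / q) = 1 := by field_simp; ring
      rw [this, ENNReal.rpow_one]
    have e2 : f s = f s ^ (p * (1 / q)) * f s ^ (p * (1 / p - 1 / q)) := by
      rw [← ENNReal.rpow_add_of_nonneg _ _ (by positivity) (by positivity)]
      have : p * (1 / q) + p * (1 / p - 1 / q) = 1 := by field_simp; ring
      rw [this, ENNReal.rpow_one]
    conv_lhs => rw [e1, e2]
    ring
  have hB' : B * B ^ ((1 / p - 1 / q) * q) = B ^ (q / p) := by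
    nth_rw 1 [← ENNReal.rpow_one B]
    rw [← ENNReal.rpow_add_of_nonneg _ _ zero_le_one (by positivity)]
    congr 1; field_simp; ring
  have hA' : A * A ^ ((1 / r - 1 / q) * q) = A ^ (q / r) := by
    nth_rw 1 [← ENNReal.rpow_one A]
    rw [← ENNReal.rpow_add_of_nonneg _ _ zero_le_one (by positivity)]
    congr 1; field_simp; ring
  calc ∫⁻ t, (∫⁻ s, h (s - t) * f s) ^ q
      ≤ ∫⁻ t, (∫⁻ s, h (s - t) ^ r * f s ^ p) *
          (B ^ ((1 / p - 1 / q) * q) * A ^ ((1 / r - 1 / q) * q)) := by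
        refine lintegral_mono fun t => ?_
        refine (ENNReal.rpow_le_rpow (hpt t) hq0.le).trans (le_of_eq ?_)
        rw [ENNReal.mul_rpow_of_nonneg _ _ hq0.le, ENNReal.mul_rpow_of_nonneg _ _ hq0.le,
          ← ENNReal.rpow_mul, ← ENNReal.rpow_mul, ← ENNReal.rpow_mul,
          one_div_mul_cancel hq0.ne', ENNReal.rpow_one]
    _ = (∫⁻ t, ∫⁻ s, h (s - t) ^ r * f s ^ p) *
          (B ^ ((1 / p - 1 / q) * q) * A ^ ((1 / r - 1 / q) * q)) :=
        lintegral_mul_const _ hmeas.lintegral_prod_right'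
    _ = (A * B) * (B ^ ((1 / p - 1 / q) * q) * A ^ ((1 / r - 1 / q) * q)) := by
        congr 1
        rw [lintegral_lintegral_swap hmeas.aemeasurable]
        have : ∀ s, ∫⁻ t, h (s - t) ^ r * f s ^ p = A * f s ^ p := fun s => by
          rw [lintegral_mul_const _ (by fun_prop), hrefl]
        simp_rw [this]
        rw [lintegral_const_mul _ (by fun_prop)]
    _ = A ^ (q / r) * B ^ (q / p) := by rw [← hA', ← hB']; ring

/-- The substitution `y = e^s`. -/
theorem lintegral_Ioi_eq_lintegral_exp (f : ℝ → ℝ≥0∞) :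
    ∫⁻ y in Set.Ioi 0, f y = ∫⁻ s, ENNReal.ofReal (Real.exp s) * f (Real.exp s) := by
  have := lintegral_image_eq_lintegral_abs_deriv_mul (s := Set.univ) MeasurableSet.univ
    (fun x _ => (Real.hasDerivAt_exp x).hasDerivWithinAt) Real.exp_injective.injOn f
  rw [Set.image_univ, Real.range_exp] at this
  simpa [abs_of_pos (Real.exp_pos _)] using this

/-! ### The measures in coordinates and the symmetry of the translation. -/

namespace Hankel

theorem measurable_side (x : ℝ) : Measurable fun z : ℝ × ℝ => side x z.1 z.2 := by
  unfold side; fun_prop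

theorem measurable_side_right (x y : ℝ) : Measurable fun θ => side x y θ := by
  unfold side; fun_prop

theorem measurable_side_uncurry : Measurable fun z : (ℝ × ℝ) × ℝ => side z.1.1 z.1.2 z.2 := by
  unfold side; fun_prop

/-- The density of `nu α`. -/
noncomputable def nuDensity (α θ : ℝ) : ℝ :=
  Real.Gamma (α + 1) / (Real.pi ^ (1 / 2 : ℝ) * Real.Gamma (α + 1 / 2)) * Real.sin θ ^ (2 * α)

theorem measurable_nuDensity (α : ℝ) : Measurable (nuDensity α) := by
  unfold nuDensity; fun_prop

theorem lintegral_mu (α : ℝ) {f : ℝ → ℝ≥0∞} (hf : Measurable f) :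
    ∫⁻ y, f y ∂(mu α) = ∫⁻ y in Set.Ioi 0, ENNReal.ofReal (y ^ (2 * α + 1)) * f y :=
  lintegral_withDensity_eq_lintegral_mul _ (by fun_prop) hf

theorem lintegral_nu (α : ℝ) {f : ℝ → ℝ≥0∞} (hf : Measurable f) :
    ∫⁻ θ, f θ ∂(nu α) =
      ∫⁻ θ in Set.Ioo 0 Real.pi, ENNReal.ofReal (nuDensity α θ) * f θ :=
  lintegral_withDensity_eq_lintegral_mul _ (measurable_nuDensity α).ennreal_ofReal hf

theorem lintegral_mu_eq_lintegral_exp (α : ℝ) {f : ℝ → ℝ≥0∞} (hf : Measurable f) :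
    ∫⁻ y, f y ∂(mu α) =
      ∫⁻ s, ENNReal.ofReal (Real.exp ((2 * α + 2) * s)) * f (Real.exp s) := by
  rw [lintegral_mu α hf, lintegral_Ioi_eq_lintegral_exp]
  refine lintegral_congr fun s => ?_
  rw [← mul_assoc, ← ENNReal.ofReal_mul (Real.exp_pos s).le, ← Real.exp_mul, ← Real.exp_add]
  congr 3; ring

theorem ae_mu_pos (α : ℝ) : ∀ᵐ x ∂(mu α), 0 < x :=
  (withDensity_absolutelyContinuous _ _).ae_le (ae_restrict_mem measurableSet_Ioi)

instance (α : ℝ) : SFinite (mu α) := by unfold mu; infer_instance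

instance (α : ℝ) : SFinite (nu α) := by unfold nu; infer_instance

/-- In polar coordinates `dμ_α(y) dν_α(θ)` is a weighted area measure on the upper half-plane,
and `(x, y)_θ` is the distance to the point `x` of the real axis. -/
theorem lintegral_mu_nu_eq_halfPlane (α x : ℝ) {Φ : ℝ → ℝ → ℝ≥0∞}
    (hΦ : Measurable (Function.uncurry Φ)) :
    ∫⁻ y, ∫⁻ θ, Φ y (side x y θ) ∂(nu α) ∂(mu α) =
      ∫⁻ w : ℝ × ℝ, (if 0 < w.2 then ENNReal.ofReal
        (Real.Gamma (α + 1) / (Real.pi ^ (1 / 2 : ℝ) * Real.Gamma (α + 1 / 2)) *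
          w.2 ^ (2 * α)) else 0) *
        Φ (Real.sqrt (w.1 ^ 2 + w.2 ^ 2)) (Real.sqrt ((x - w.1) ^ 2 + w.2 ^ 2)) := by
  set c := Real.Gamma (α + 1) / (Real.pi ^ (1 / 2 : ℝ) * Real.Gamma (α + 1 / 2)) with hc
  have hm : Measurable fun z : ℝ × ℝ => Φ z.1 (side x z.1 z.2) :=
    hΦ.comp (measurable_fst.prodMk (measurable_side x))
  rw [lintegral_mu α hm.lintegral_prod_right', ← lintegral_comp_polarCoord_symm]
  have hd := measurable_nuDensity α
  have hG : Measurable fun z : ℝ × ℝ => ENNReal.ofReal (z.1 ^ (2 * α + 1)) *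
      (ENNReal.ofReal (nuDensity α z.2) * Φ z.1 (side x z.1 z.2)) :=
    (by fun_prop : Measurable fun z : ℝ × ℝ => ENNReal.ofReal (z.1 ^ (2 * α + 1))).mul
      ((hd.comp measurable_snd).ennreal_ofReal.mul hm)
  have hL : ∫⁻ y in Set.Ioi 0, ENNReal.ofReal (y ^ (2 * α + 1)) *
      ∫⁻ θ, Φ y (side x y θ) ∂(nu α) =
      ∫⁻ z in Set.Ioi (0 : ℝ) ×ˢ Set.Ioo 0 Real.pi, ENNReal.ofReal (z.1 ^ (2 * α + 1)) *
      (ENNReal.ofReal (nuDensity α z.2) * Φ z.1 (side x z.1 z.2)) := by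
    rw [Measure.volume_eq_prod, ← Measure.prod_restrict, lintegral_prod _ hG.aemeasurable]
    refine lintegral_congr fun y => ?_
    have hy : Measurable fun θ => Φ y (side x y θ) := hm.comp measurable_prodMk_left
    rw [lintegral_nu α hy]
    exact (lintegral_const_mul _ (hd.ennreal_ofReal.mul hy)).symm
  rw [hL, polarCoord_target, ← lintegral_indicator (by measurability),
    ← lintegral_indicator (by measurability)]
  refine lintegral_congr fun z => ?_
  obtain ⟨y, θ⟩ := z
  simp only [Set.indicator_apply, Set.mem_prod, Set.mem_Ioi, Set.mem_Ioo, polarCoord_symm_apply,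
    smul_eq_mul]
  by_cases hy : 0 < y
  swap
  · simp [hy]
  by_cases hθ : -Real.pi < θ ∧ θ < Real.pi
  swap
  · have : ¬ (0 < θ ∧ θ < Real.pi) := fun h => hθ ⟨by linarith [Real.pi_pos], h.2⟩
    simp [hθ, this]
  -- Polar coordinates cover angles in `(-π, π)`; the cutoff `0 < w.2` removes those with `θ ≤ 0`.
  by_cases h0 : 0 < θ
  swap
  · have : ¬ 0 < y * Real.sin θ := by
      have := Real.sin_nonpos_of_nonpos_of_neg_pi_le (not_lt.1 h0) hθ.1.le
      exact not_lt.2 (mul_nonpos_of_nonneg_of_nonpos hy.le this)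
    simp [h0, this]
  have hs : 0 < Real.sin θ := Real.sin_pos_of_pos_of_lt_pi h0 hθ.2
  rw [if_pos ⟨hy, h0, hθ.2⟩, if_pos ⟨hy, hθ⟩, if_pos (mul_pos hy hs)]
  have e1 : Real.sqrt ((y * Real.cos θ) ^ 2 + (y * Real.sin θ) ^ 2) = y := by
    rw [← Real.sqrt_sq hy.le]; congr 1
    rw [Real.sqrt_sq hy.le]
    linear_combination y ^ 2 * Real.sin_sq_add_cos_sq θ
  have e2 : Real.sqrt ((x - y * Real.cos θ) ^ 2 + (y * Real.sin θ) ^ 2) = side x y θ := by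
    unfold side; congr 1
    linear_combination y ^ 2 * Real.sin_sq_add_cos_sq θ
  rw [e1, e2, ← mul_assoc, ← mul_assoc, ← ENNReal.ofReal_mul (by positivity),
    ← ENNReal.ofReal_mul hy.le]
  congr 2
  rw [nuDensity, ← hc, Real.mul_rpow hy.le hs.le, Real.rpow_add_one hy.ne']
  ring

/-- The generalized translation is symmetric: `(x, y)_θ` and `y` may be exchanged. -/
theorem lintegral_mu_nu_swap (α x : ℝ) {Φ : ℝ → ℝ → ℝ≥0∞}
    (hΦ : Measurable (Function.uncurry Φ)) :
    ∫⁻ y, ∫⁻ θ, Φ (side x y θ) y ∂(nu α) ∂(mu α) =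
      ∫⁻ y, ∫⁻ θ, Φ y (side x y θ) ∂(nu α) ∂(mu α) := by
  have hΦ' : Measurable (Function.uncurry fun a b => Φ b a) := hΦ.comp measurable_swap
  rw [lintegral_mu_nu_eq_halfPlane α x hΦ, lintegral_mu_nu_eq_halfPlane α x hΦ']
  -- This reflection exchanges the distances to `0` and to `x` and keeps the height, hence the
  -- weight.
  have hmp : MeasurePreserving (fun w : ℝ × ℝ => (x - w.1, w.2)) :=
    (Measure.measurePreserving_sub_left volume x).prod (MeasurePreserving.id volume)
  rw [← hmp.lintegral_comp]
  · simp
  · refine Measurable.mul (Measurable.ite (measurableSet_lt measurable_const measurable_snd)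
      (by fun_prop) measurable_const) ?_
    exact hΦ'.comp (f := fun w : ℝ × ℝ =>
      (Real.sqrt (w.1 ^ 2 + w.2 ^ 2), Real.sqrt ((x - w.1) ^ 2 + w.2 ^ 2))) (by fun_prop)

end Hankel

/-! ### Elementary estimates for powers, sine and exponentials. -/

/-- A power is monotone in one direction or the other; the sum of the endpoint values covers both
signs of `γ`, as needed for `γ = 2α`. -/
theorem Real.rpow_le_rpow_add_rpow_of_mem_Icc {l x v : ℝ} (γ : ℝ) (hl : 0 < l) (hlx : l ≤ x)
    (hxv : x ≤ v) : x ^ γ ≤ l ^ γ + v ^ γ := by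
  have hx : 0 < x := hl.trans_le hlx
  have hv : 0 < v := hx.trans_le hxv
  rcases le_total 0 γ with h | h
  · have := Real.rpow_le_rpow hx.le hxv h
    have := Real.rpow_nonneg hl.le γ
    linarith
  · have := Real.rpow_le_rpow_of_nonpos hl hlx h
    have := Real.rpow_nonneg hv.le γ
    linarith

/-- Jordan's inequality places `sin θ / θ` in `[2/π, 1]`. -/
theorem Real.sin_rpow_le {θ : ℝ} (γ : ℝ) (h0 : 0 < θ) (h1 : θ ≤ Real.pi / 2) :
    Real.sin θ ^ γ ≤ ((2 / Real.pi) ^ γ + 1) * θ ^ γ := by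
  have hs := Real.mul_le_sin h0.le h1
  have hs' := Real.sin_le h0.le
  have := Real.rpow_le_rpow_add_rpow_of_mem_Icc (l := 2 / Real.pi) (x := Real.sin θ / θ) (v := 1)
    γ (by positivity) (by rwa [le_div_iff₀ h0]) (by rwa [div_le_one h0])
  rw [Real.one_rpow, Real.div_rpow (le_trans (by positivity) hs) h0.le,
    div_le_iff₀ (Real.rpow_pos_of_pos h0 _)] at this
  exact this

theorem integrableOn_abs_rpow_Icc {γ : ℝ} (hγ : -1 < γ) :
    IntegrableOn (fun u : ℝ => |u| ^ γ) (Set.Icc (-1) 1) := by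
  have h1 : IntervalIntegrable (fun u : ℝ => |u| ^ γ) volume 0 1 := by
    refine (intervalIntegral.intervalIntegrable_rpow' hγ).congr ?_
    intro u hu
    rw [Set.uIoc_of_le zero_le_one] at hu
    simp only [abs_of_pos hu.1]
  have h2 : IntervalIntegrable (fun u : ℝ => |u| ^ γ) volume (-1) 0 := by
    have := (h1.comp_sub_left 0).symm
    simpa using this
  rw [← intervalIntegrable_iff_integrableOn_Icc_of_le (by norm_num)]
  exact h2.trans h1

theorem integrable_exp_neg_mul_abs {c : ℝ} (hc : 0 < c) :
    Integrable fun u : ℝ => Real.exp (-c * |u|) := by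
  rw [← integrableOn_univ, ← Set.Iic_union_Ioi (a := (0 : ℝ))]
  refine IntegrableOn.union ?_ ?_
  · refine (integrableOn_exp_mul_Iic hc 0).congr_fun (fun u hu => ?_) measurableSet_Iic
    simp only [abs_of_nonpos (Set.mem_Iic.1 hu)]; ring_nf
  · refine (integrableOn_exp_mul_Ioi (neg_lt_zero.2 hc) 0).congr_fun (fun u hu => ?_)
      measurableSet_Ioi
    simp only [abs_of_pos (Set.mem_Ioi.1 hu)]

/-! ### The translated kernel in logarithmic variables. -/

namespace Hankel

/-- The `ν_α`-integral of `sin(θ/2)^{-b}`. -/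
theorem lintegral_nu_sin_half_rpow_lt_top {α b : ℝ} (hα : -1 / 2 < α) (hb0 : 0 ≤ b)
    (hb : b < 2 * α + 1) :
    ∫⁻ θ, ENNReal.ofReal (Real.sin (θ / 2) ^ (-b)) ∂(nu α) < ∞ := by
  rw [lintegral_nu α (by fun_prop)]
  unfold nuDensity
  set c := Real.Gamma (α + 1) / (Real.pi ^ (1 / 2 : ℝ) * Real.Gamma (α + 1 / 2)) with hc
  have hc0 : 0 ≤ c := by
    have h1 := Real.Gamma_pos_of_pos (s := α + 1) (by linarith)
    have h2 := Real.Gamma_pos_of_pos (s := α + 1 / 2) (by linarith)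
    have := Real.pi_pos
    positivity
  set C := (2 / Real.pi) ^ (2 * α) + 1 with hC
  have hC0 : 0 ≤ C := by have := Real.pi_pos; positivity
  -- The first term dominates on `(0, π/2]` and is integrable as `2α - b > -1`; the second dominates
  -- near `π`, where `sin(θ/2) ≥ 1/2`, and is integrable as `2α > -1`.
  have hpt : ∀ θ ∈ Set.Ioo 0 Real.pi,
      ENNReal.ofReal (c * Real.sin θ ^ (2 * α)) * ENNReal.ofReal (Real.sin (θ / 2) ^ (-b)) ≤
      ENNReal.ofReal (c * (C * Real.pi ^ b * θ ^ (2 * α - b) +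
        C * 2 ^ b * (Real.pi - θ) ^ (2 * α))) := by
    rintro θ ⟨h0, hπ⟩
    have hs : 0 < Real.sin θ := Real.sin_pos_of_pos_of_lt_pi h0 hπ
    rw [← ENNReal.ofReal_mul (by positivity), mul_assoc]
    refine ENNReal.ofReal_le_ofReal (mul_le_mul_of_nonneg_left ?_ hc0)
    have hhalf : θ / Real.pi ≤ Real.sin (θ / 2) := by
      have := Real.mul_le_sin (x := θ / 2) (by linarith) (by linarith)
      calc θ / Real.pi = 2 / Real.pi * (θ / 2) := by ring
        _ ≤ _ := this
    have hθπ : 0 < Real.pi - θ := by linarith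
    have hpos1 : 0 ≤ C * Real.pi ^ b * θ ^ (2 * α - b) := by positivity
    have hpos2 : 0 ≤ C * 2 ^ b * (Real.pi - θ) ^ (2 * α) := by positivity
    rcases le_or_gt θ (Real.pi / 2) with h | h
    · have e1 := Real.sin_rpow_le (2 * α) h0 h
      have e2 := Real.rpow_le_rpow_of_nonpos (z := -b) (by positivity) hhalf (by linarith)
      refine (mul_le_mul e1 e2 (Real.rpow_nonneg (le_trans (by positivity) hhalf) _)
        (by positivity)).trans (le_trans (le_of_eq ?_) (le_add_of_nonneg_right hpos2))
      rw [Real.div_rpow h0.le Real.pi_pos.le, Real.rpow_neg Real.pi_pos.le, sub_eq_add_neg,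
        Real.rpow_add h0, div_inv_eq_mul]
      ring
    · have e1 := Real.sin_rpow_le (2 * α) hθπ (by linarith)
      rw [Real.sin_pi_sub] at e1
      have hhalf' : (2 : ℝ)⁻¹ ≤ Real.sin (θ / 2) := by
        refine le_trans ?_ hhalf
        rw [le_div_iff₀ Real.pi_pos]; linarith
      have e2 := Real.rpow_le_rpow_of_nonpos (z := -b) (by positivity) hhalf' (by linarith)
      rw [Real.inv_rpow zero_le_two, Real.rpow_neg zero_le_two, inv_inv] at e2
      refine (mul_le_mul e1 e2 (Real.rpow_nonneg (le_trans (by positivity) hhalf) _)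
        (by positivity)).trans (le_trans (le_of_eq ?_) (le_add_of_nonneg_left hpos1))
      ring
  refine lt_of_le_of_lt (setLIntegral_mono' measurableSet_Ioo hpt) ?_
  refine Integrable.lintegral_lt_top ?_
  have i1 : IntervalIntegrable (fun θ : ℝ => θ ^ (2 * α - b)) volume 0 Real.pi :=
    intervalIntegral.intervalIntegrable_rpow' (by linarith)
  have i2 : IntervalIntegrable (fun θ : ℝ => (Real.pi - θ) ^ (2 * α)) volume 0 Real.pi := by
    have := (intervalIntegral.intervalIntegrable_rpow' (a := Real.pi) (b := 0) (r := 2 * α)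
      (by linarith)).comp_sub_left Real.pi
    simpa using this
  have i3 := ((i1.const_mul (C * Real.pi ^ b)).add (i2.const_mul (C * 2 ^ b))).const_mul c
  rw [intervalIntegrable_iff_integrableOn_Ioo_of_le Real.pi_pos.le] at i3
  exact i3

/-- In logarithmic variables, up to an exponential factor, the generalized translation of the
power function with exponent `-d`. -/
noncomputable def logKernel (α d u : ℝ) : ℝ≥0∞ :=
  ∫⁻ θ, ENNReal.ofReal
    ((2 * Real.sqrt (Real.sinh (u / 2) ^ 2 + Real.sin (θ / 2) ^ 2)) ^ (-d)) ∂(nu α)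

theorem measurable_logKernel (α d : ℝ) : Measurable (logKernel α d) := by
  refine Measurable.lintegral_prod_right' (f := fun z : ℝ × ℝ => ENNReal.ofReal
    ((2 * Real.sqrt (Real.sinh (z.1 / 2) ^ 2 + Real.sin (z.2 / 2) ^ 2)) ^ (-d))) ?_
  fun_prop

/-- The squared side is `(x-y)² + 4xy sin²(θ/2)`, and `e^s - e^t = 2 e^{(s+t)/2} sinh((s-t)/2)`. -/
theorem side_exp (t s θ : ℝ) : side (Real.exp t) (Real.exp s) θ =
    Real.exp ((s + t) / 2) *
      (2 * Real.sqrt (Real.sinh ((s - t) / 2) ^ 2 + Real.sin (θ / 2) ^ 2)) := by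
  have hA : (0 : ℝ) ≤ Real.sinh ((s - t) / 2) ^ 2 + Real.sin (θ / 2) ^ 2 := by positivity
  unfold side
  rw [← Real.sqrt_sq (by positivity : 0 ≤ Real.exp ((s + t) / 2) *
    (2 * Real.sqrt (Real.sinh ((s - t) / 2) ^ 2 + Real.sin (θ / 2) ^ 2)))]
  congr 1
  rw [mul_pow, mul_pow, Real.sq_sqrt hA, Real.sinh_eq]
  have h1 : Real.cos θ = 1 - 2 * Real.sin (θ / 2) ^ 2 := by
    have := Real.cos_two_mul' (θ / 2)
    rw [mul_div_cancel₀ θ two_ne_zero] at this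
    linear_combination this + Real.sin_sq_add_cos_sq (θ / 2)
  have h2 : Real.exp ((s + t) / 2) = Real.exp (s / 2) * Real.exp (t / 2) := by
    rw [← Real.exp_add]; ring_nf
  have h3 : Real.exp ((s - t) / 2) = Real.exp (s / 2) * (Real.exp (t / 2))⁻¹ := by
    rw [← Real.exp_neg, ← Real.exp_add]; ring_nf
  have h4 : Real.exp (-((s - t) / 2)) = (Real.exp (s / 2))⁻¹ * Real.exp (t / 2) := by
    rw [← Real.exp_neg, ← Real.exp_add]; ring_nf
  have h5 : Real.exp t = Real.exp (t / 2) ^ 2 := by rw [← Real.exp_nat_mul]; push_cast; ring_nf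
  have h6 : Real.exp s = Real.exp (s / 2) ^ 2 := by rw [← Real.exp_nat_mul]; push_cast; ring_nf
  have h7 := Real.exp_pos (t / 2)
  have h8 := Real.exp_pos (s / 2)
  rw [h1, h2, h3, h4, h5, h6]
  field_simp
  ring

theorem lintegral_nu_side_exp (α d t s : ℝ) :
    ∫⁻ θ, ENNReal.ofReal (side (Real.exp t) (Real.exp s) θ ^ (-d)) ∂(nu α) =
      ENNReal.ofReal (Real.exp (-d * (s + t) / 2)) * logKernel α d (s - t) := by
  unfold logKernel
  rw [← lintegral_const_mul _ (by fun_prop)]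
  refine lintegral_congr fun θ => ?_
  rw [side_exp, Real.mul_rpow (Real.exp_pos _).le (by positivity),
    ENNReal.ofReal_mul (by positivity), ← Real.exp_mul]
  congr 3; ring

/-- The base dominates both `|2 sinh(u/2)|` and `sin(θ/2)`, so the exponent can be shared: `b` goes
to the `θ`-integral, and only `a` remains as a singularity in `u`. -/
theorem logKernel_le {α a b u : ℝ} (ha : 0 ≤ a) (hb : 0 ≤ b) (hu : u ≠ 0) :
    logKernel α (a + b) u ≤ ENNReal.ofReal (|2 * Real.sinh (u / 2)| ^ (-a)) *
      ∫⁻ θ, ENNReal.ofReal (Real.sin (θ / 2) ^ (-b)) ∂(nu α) := by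
  have hu2 : Real.sinh (u / 2) ≠ 0 := by simpa using hu
  unfold logKernel
  rw [← lintegral_const_mul _ (by fun_prop)]
  refine lintegral_mono_ae ?_
  have hae : ∀ᵐ θ ∂(nu α), θ ∈ Set.Ioo 0 Real.pi :=
    (withDensity_absolutelyContinuous _ _).ae_le (ae_restrict_mem measurableSet_Ioo)
  filter_upwards [hae] with θ hθ
  have hs : 0 < Real.sin (θ / 2) :=
    Real.sin_pos_of_pos_of_lt_pi (by linarith [hθ.1]) (by linarith [hθ.1, hθ.2])
  set S := Real.sqrt (Real.sinh (u / 2) ^ 2 + Real.sin (θ / 2) ^ 2) with hS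
  have h1 : |Real.sinh (u / 2)| ≤ S := Real.abs_le_sqrt (by nlinarith [sq_nonneg (Real.sin (θ / 2))])
  have h2 : Real.sin (θ / 2) ≤ S :=
    Real.le_sqrt_of_sq_le (by nlinarith [sq_nonneg (Real.sinh (u / 2))])
  have h1' : |2 * Real.sinh (u / 2)| ≤ 2 * S := by
    rw [abs_mul, abs_two]; linarith
  have hpos : 0 < |2 * Real.sinh (u / 2)| := by positivity
  rw [← ENNReal.ofReal_mul (by positivity)]
  refine ENNReal.ofReal_le_ofReal ?_
  rw [neg_add, Real.rpow_add (by linarith)]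
  exact mul_le_mul (Real.rpow_le_rpow_of_nonpos hpos h1' (by linarith))
    (Real.rpow_le_rpow_of_nonpos hs (by linarith) (by linarith)) (by positivity) (by positivity)

theorem abs_le_abs_two_mul_sinh_half (u : ℝ) : |u| ≤ |2 * Real.sinh (u / 2)| := by
  have h : |2 * Real.sinh (u / 2)| = 2 * Real.sinh (|u| / 2) := by
    rw [abs_mul, abs_two, Real.abs_sinh, abs_div, abs_two]
  have := Real.self_le_sinh_iff.2 (by positivity : 0 ≤ |u| / 2)
  linarith

theorem exp_half_abs_le_abs_two_mul_sinh_half {u : ℝ} (hu : 1 ≤ |u|) :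
    Real.exp (|u| / 2) / 2 ≤ |2 * Real.sinh (u / 2)| := by
  have h : |2 * Real.sinh (u / 2)| = 2 * Real.sinh (|u| / 2) := by
    rw [abs_mul, abs_two, Real.abs_sinh, abs_div, abs_two]
  rw [h, Real.sinh_eq]
  have h1 : Real.exp (|u| / 2) = Real.exp (-(|u| / 2)) * Real.exp |u| := by
    rw [← Real.exp_add]; ring_nf
  have h2 := Real.add_one_le_exp |u|
  have h3 := Real.exp_pos (-(|u| / 2))
  nlinarith

/-- For `|u| ≤ 1` the split `(a, b)` leaves `|u|^{-ar}`, integrable as `ar < 1`. For `|u| > 1` the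
split `(a + b, 0)` gives decay `e^{-(a+b)|u|/2}`, which outweighs `e^{κu}`. -/
theorem lintegral_logKernel_rpow_lt_top {α a b r κ : ℝ} (hα : -1 / 2 < α) (ha : 0 < a)
    (hb : 0 ≤ b) (hb' : b < 2 * α + 1) (hr : 0 < r) (har : a * r < 1) (hκ : |κ| < (a + b) / 2) :
    ∫⁻ u, (ENNReal.ofReal (Real.exp (κ * u)) * logKernel α (a + b) u) ^ r < ∞ := by
  -- The total mass of `ν_α`, written in the form that `logKernel_le` produces for `b = 0`.
  set N0 := ∫⁻ θ, ENNReal.ofReal (Real.sin (θ / 2) ^ (-0 : ℝ)) ∂(nu α) with hN0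
  set Nb := ∫⁻ θ, ENNReal.ofReal (Real.sin (θ / 2) ^ (-b)) ∂(nu α) with hNb
  have hN0t : N0 < ∞ := lintegral_nu_sin_half_rpow_lt_top hα le_rfl (by linarith)
  have hNbt : Nb < ∞ := lintegral_nu_sin_half_rpow_lt_top hα hb hb'
  set ε := (a + b) / 2 - |κ| with hε
  have hε0 : 0 < ε := by linarith
  have hnear : ∫⁻ u in Set.Icc (-1) 1,
      (ENNReal.ofReal (Real.exp (κ * u)) * logKernel α (a + b) u) ^ r < ∞ := by
    have hb : ∀ᵐ u : ℝ ∂(volume.restrict (Set.Icc (-1) 1)),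
        (ENNReal.ofReal (Real.exp (κ * u)) * logKernel α (a + b) u) ^ r ≤
        ENNReal.ofReal (|u| ^ (-(a * r))) * (ENNReal.ofReal (Real.exp |κ|) * Nb) ^ r := by
      have h0 : ∀ᵐ u : ℝ ∂(volume.restrict (Set.Icc (-1) 1)), u ≠ 0 :=
        ae_restrict_of_ae (Measure.ae_ne volume 0)
      filter_upwards [h0, ae_restrict_mem measurableSet_Icc] with u hu hu1
      have hu' : |u| ≤ 1 := abs_le.2 hu1
      have hupos : 0 < |u| := abs_pos.2 hu
      have e1 : Real.exp (κ * u) ≤ Real.exp |κ| := by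
        refine Real.exp_le_exp.2 ((le_abs_self _).trans ?_)
        rw [abs_mul]
        exact mul_le_of_le_one_right (abs_nonneg _) hu'
      have e2 : logKernel α (a + b) u ≤ ENNReal.ofReal (|u| ^ (-a)) * Nb := by
        refine (logKernel_le ha.le hb hu).trans (mul_le_mul_left (ENNReal.ofReal_le_ofReal ?_) _)
        exact Real.rpow_le_rpow_of_nonpos hupos (abs_le_abs_two_mul_sinh_half u) (by linarith)
      calc _ ≤ (ENNReal.ofReal (Real.exp |κ|) * (ENNReal.ofReal (|u| ^ (-a)) * Nb)) ^ r :=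
            ENNReal.rpow_le_rpow (mul_le_mul' (ENNReal.ofReal_le_ofReal e1) e2) hr.le
        _ = (ENNReal.ofReal (|u| ^ (-a)) * (ENNReal.ofReal (Real.exp |κ|) * Nb)) ^ r := by ring_nf
        _ = _ := by
            rw [ENNReal.mul_rpow_of_nonneg _ _ hr.le, ENNReal.ofReal_rpow_of_nonneg
              (by positivity) hr.le, ← Real.rpow_mul hupos.le, neg_mul]
    refine (lintegral_mono_ae hb).trans_lt ?_
    rw [lintegral_mul_const _ (by fun_prop)]
    refine ENNReal.mul_lt_top ?_ (ENNReal.rpow_lt_top_of_nonneg hr.le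
      (ENNReal.mul_lt_top ENNReal.ofReal_lt_top hNbt).ne)
    exact (integrableOn_abs_rpow_Icc (by linarith)).lintegral_lt_top
  have hfar : ∫⁻ u in (Set.Icc (-1) 1)ᶜ,
      (ENNReal.ofReal (Real.exp (κ * u)) * logKernel α (a + b) u) ^ r < ∞ := by
    have hb : ∀ u ∈ (Set.Icc (-1 : ℝ) 1)ᶜ,
        (ENNReal.ofReal (Real.exp (κ * u)) * logKernel α (a + b) u) ^ r ≤
        ENNReal.ofReal (Real.exp (-(ε * r) * |u|)) * (ENNReal.ofReal (2 ^ (a + b)) * N0) ^ r := by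
      intro u hu
      have hu1 : 1 < |u| := by
        by_contra h
        exact hu (abs_le.1 (not_lt.1 h))
      have hu0 : u ≠ 0 := by rintro rfl; simp at hu1; linarith
      have e2 : logKernel α (a + b) u ≤
          ENNReal.ofReal (Real.exp (-(a + b) / 2 * |u|) * 2 ^ (a + b)) * N0 := by
        have := logKernel_le (α := α) (a := a + b) (b := 0) (by linarith) le_rfl hu0
        rw [add_zero] at this
        refine this.trans (mul_le_mul_left (ENNReal.ofReal_le_ofReal ?_) _)
        refine (Real.rpow_le_rpow_of_nonpos (by positivity)
          (exp_half_abs_le_abs_two_mul_sinh_half hu1.le) (by linarith)).trans (le_of_eq ?_)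
        rw [Real.div_rpow (Real.exp_pos _).le zero_le_two, ← Real.exp_mul,
          Real.rpow_neg zero_le_two, div_inv_eq_mul]
        congr 2; ring
      have e3 : Real.exp (κ * u) * (Real.exp (-(a + b) / 2 * |u|) * 2 ^ (a + b)) ≤
          Real.exp (-ε * |u|) * 2 ^ (a + b) := by
        rw [← mul_assoc, ← Real.exp_add]
        refine mul_le_mul_of_nonneg_right (Real.exp_le_exp.2 ?_) (by positivity)
        have := le_abs_self (κ * u)
        rw [abs_mul] at this
        rw [hε]; linarith
      calc _ ≤ (ENNReal.ofReal (Real.exp (κ * u)) *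
              (ENNReal.ofReal (Real.exp (-(a + b) / 2 * |u|) * 2 ^ (a + b)) * N0)) ^ r :=
            ENNReal.rpow_le_rpow (mul_le_mul_right e2 _) hr.le
        _ ≤ (ENNReal.ofReal (Real.exp (-ε * |u|)) * (ENNReal.ofReal (2 ^ (a + b)) * N0)) ^ r := by
            refine ENNReal.rpow_le_rpow ?_ hr.le
            rw [← mul_assoc, ← mul_assoc, ← ENNReal.ofReal_mul (by positivity),
              ← ENNReal.ofReal_mul (by positivity)]
            exact mul_le_mul_left (ENNReal.ofReal_le_ofReal e3) _
        _ = _ := by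
            rw [ENNReal.mul_rpow_of_nonneg _ _ hr.le, ENNReal.ofReal_rpow_of_nonneg
              (by positivity) hr.le, ← Real.exp_mul]
            congr 3; ring
    refine (setLIntegral_mono' measurableSet_Icc.compl hb).trans_lt ?_
    rw [lintegral_mul_const _ (by fun_prop)]
    refine ENNReal.mul_lt_top ?_ (ENNReal.rpow_lt_top_of_nonneg hr.le
      (ENNReal.mul_lt_top ENNReal.ofReal_lt_top hN0t).ne)
    exact (integrable_exp_neg_mul_abs (mul_pos hε0 hr)).integrableOn.lintegral_lt_top
  rw [← lintegral_add_compl _ (measurableSet_Icc (a := (-1 : ℝ)) (b := 1))]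
  exact ENNReal.add_lt_top.2 ⟨hnear, hfar⟩

/-! ### The inequality for nonnegative functions. -/

/-- The Hardy–Littlewood–Sobolev inequality for the generalized convolution of nonnegative
functions, with the constant expressed through `logKernel`. -/
theorem lintegral_mu_conv_rpow_le {α p q r d : ℝ} (hp : 1 < p) (hpq : p < q) (hr : 0 < r)
    (hpqr : 1 / p + 1 / r = 1 + 1 / q) (hd : d = (2 * α + 2) / r) {f : ℝ → ℝ≥0∞}
    (hf : Measurable f) :
    ∫⁻ x, (∫⁻ y, ∫⁻ θ, f (side x y θ) * ENNReal.ofReal (y ^ (-d)) ∂(nu α) ∂(mu α)) ^ q ∂(mu α) ≤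
      (∫⁻ u, (ENNReal.ofReal (Real.exp ((d / 2 - (2 * α + 2) / q) * u)) *
        logKernel α d u) ^ r) ^ (q / r) * (∫⁻ y, f y ^ p ∂(mu α)) ^ (q / p) := by
  have hp0 : 0 < p := by linarith
  have hq0 : 0 < q := by linarith
  set D := 2 * α + 2 with hD
  set κ := d / 2 - D / q with hκ
  -- The scaling relation: it makes the exponential weights combine into a function of `s - t` times
  -- `e^{Ds/p}`.
  have hdD : D - d / 2 = κ + D / p := by
    have : d = D * (1 / r) := by rw [hd]; ring
    rw [show 1 / r = 1 + 1 / q - 1 / p by linarith] at this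
    rw [hκ]
    have e1 : D / q = D * (1 / q) := by ring
    have e2 : D / p = D * (1 / p) := by ring
    rw [e1, e2]; linarith
  have hK : Measurable fun z : ℝ × ℝ => ∫⁻ θ, ENNReal.ofReal (side z.1 z.2 θ ^ (-d)) ∂(nu α) := by
    refine Measurable.lintegral_prod_right' (f := fun z : (ℝ × ℝ) × ℝ =>
      ENNReal.ofReal (side z.1.1 z.1.2 z.2 ^ (-d))) ?_
    exact (measurable_side_uncurry.pow_const _).ennreal_ofReal
  have hswap : ∀ x, ∫⁻ y, ∫⁻ θ, f (side x y θ) * ENNReal.ofReal (y ^ (-d)) ∂(nu α) ∂(mu α) =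
      ∫⁻ y, f y * ∫⁻ θ, ENNReal.ofReal (side x y θ ^ (-d)) ∂(nu α) ∂(mu α) := by
    intro x
    rw [lintegral_mu_nu_swap α x (Φ := fun a b => f a * ENNReal.ofReal (b ^ (-d)))
      (by simp only [Function.uncurry_def]; fun_prop)]
    refine lintegral_congr fun y => lintegral_const_mul _ ?_
    exact ((measurable_side_right x y).pow_const _).ennreal_ofReal
  simp_rw [hswap]
  have hG : Measurable fun x => ∫⁻ y, f y *
      ∫⁻ θ, ENNReal.ofReal (side x y θ ^ (-d)) ∂(nu α) ∂(mu α) := by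
    refine Measurable.lintegral_prod_right' (f := fun z : ℝ × ℝ => f z.2 *
      ∫⁻ θ, ENNReal.ofReal (side z.1 z.2 θ ^ (-d)) ∂(nu α)) ?_
    exact (hf.comp measurable_snd).mul hK
  have hH := measurable_logKernel α d
  rw [lintegral_mu_eq_lintegral_exp α (hG.pow_const q),
    lintegral_mu_eq_lintegral_exp α (hf.pow_const p)]
  refine le_trans (le_of_eq ?_) ((lintegral_conv_rpow_le hp hpq hr hpqr
    -- The factor `e^{Ds/p}` makes the passage from `L^p(μ_α)` to `L^p(ℝ)` isometric.
    (f := fun s => ENNReal.ofReal (Real.exp (D / p * s)) * f (Real.exp s))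
    (h := fun u => ENNReal.ofReal (Real.exp (κ * u)) * logKernel α d u)
    (by fun_prop) (by fun_prop)).trans (le_of_eq ?_))
  · refine lintegral_congr fun t => ?_
    have e1 : ENNReal.ofReal (Real.exp (D * t)) = ENNReal.ofReal (Real.exp (D / q * t)) ^ q := by
      rw [ENNReal.ofReal_rpow_of_pos (Real.exp_pos _), ← Real.exp_mul]
      congr 2; field_simp
    rw [e1, ← ENNReal.mul_rpow_of_nonneg _ _ hq0.le]
    congr 1
    have hm : Measurable fun y => f y *
        ∫⁻ θ, ENNReal.ofReal (side (Real.exp t) y θ ^ (-d)) ∂(nu α) := by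
      have hk := hK.comp (measurable_prodMk_left (x := Real.exp t))
      exact hf.mul hk
    rw [lintegral_mu_eq_lintegral_exp α hm]
    refine (lintegral_const_mul _ ((by fun_prop : Measurable fun s =>
      ENNReal.ofReal (Real.exp (D * s))).mul (hm.comp Real.measurable_exp))).symm.trans
      (lintegral_congr fun s => ?_)
    simp only [Pi.mul_apply, Function.comp_apply]
    rw [lintegral_nu_side_exp]
    have e2 : ENNReal.ofReal (Real.exp (D / q * t)) * (ENNReal.ofReal (Real.exp (D * s)) *
        ENNReal.ofReal (Real.exp (-d * (s + t) / 2))) =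
        ENNReal.ofReal (Real.exp (κ * (s - t))) * ENNReal.ofReal (Real.exp (D / p * s)) := by
      rw [← ENNReal.ofReal_mul (Real.exp_pos _).le, ← ENNReal.ofReal_mul (Real.exp_pos _).le,
        ← ENNReal.ofReal_mul (Real.exp_pos _).le, ← Real.exp_add, ← Real.exp_add, ← Real.exp_add]
      congr 2
      have : D = κ + D / p + d / 2 := by linarith
      have h2 : D / q = d / 2 - κ := by rw [hκ]; ring
      rw [h2]
      nth_rw 1 [this]
      ring
    calc _ = (ENNReal.ofReal (Real.exp (D / q * t)) * (ENNReal.ofReal (Real.exp (D * s)) *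
        ENNReal.ofReal (Real.exp (-d * (s + t) / 2)))) *
          (f (Real.exp s) * logKernel α d (s - t)) := by ring
      _ = _ := by rw [e2]; ring
  · congr 2
    refine lintegral_congr fun s => ?_
    rw [ENNReal.mul_rpow_of_nonneg _ _ hp0.le, ENNReal.ofReal_rpow_of_pos (Real.exp_pos _),
      ← Real.exp_mul, ← hD]
    congr 3; field_simp

theorem exists_lintegral_mu_conv_rpow_le {α p q r d : ℝ} (hα : -1 / 2 < α) (hp : 1 < p)
    (hpq : p < q) (hr : 0 < r) (hpqr : 1 / p + 1 / r = 1 + 1 / q) (hd : d = (2 * α + 2) / r) :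
    ∃ C : ℝ≥0, ∀ f : ℝ → ℝ≥0∞, Measurable f →
      ∫⁻ x, (∫⁻ y, ∫⁻ θ, f (side x y θ) * ENNReal.ofReal (y ^ (-d)) ∂(nu α) ∂(mu α)) ^ q ∂(mu α) ≤
        C * (∫⁻ y, f y ^ p ∂(mu α)) ^ (q / p) := by
  have hp0 : 0 < p := by linarith
  have hq0 : 0 < q := by linarith
  have h1p : 1 / p < 1 := by rw [div_lt_one hp0]; exact hp
  have h1q : 0 < 1 / q := by positivity
  have hqp : 1 / q < 1 / p := one_div_lt_one_div_of_lt hp0 hpq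
  have hr0 : 0 < 1 / r := by positivity
  have hr1 : 1 / r < 1 := by linarith
  have hd' : d = (2 * α + 2) * (1 / r) := by rw [hd]; ring
  -- With `b = d - a`, the lower bound is `b < 2α + 1` and the upper one `ar < 1`. There is room
  -- because `(2α+1)/r < 2α+1`, from `r > 1` and `α > -1/2`.
  obtain ⟨a, ha, har⟩ : ∃ a, max 0 (d - (2 * α + 1)) < a ∧ a < 1 / r := by
    refine exists_between (max_lt hr0 ?_)
    rw [hd']; nlinarith
  rw [max_lt_iff] at ha
  -- Equivalent to `0 < (2α+2)/q < d`, that is `0 < 1/q < 1/r`; the last inequality is `p > 1`.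
  have hκ : |d / 2 - (2 * α + 2) / q| < (a + (d - a)) / 2 := by
    have e : (2 * α + 2) / q = (2 * α + 2) * (1 / q) := by ring
    rw [e, abs_lt]
    constructor
    · rw [hd']; nlinarith
    · nlinarith
  have hA := lintegral_logKernel_rpow_lt_top hα ha.1 (b := d - a) (by rw [hd']; nlinarith)
    (by linarith) hr (by rwa [lt_div_iff₀ hr] at har) hκ
  rw [add_sub_cancel] at hA
  have hA' := ENNReal.rpow_lt_top_of_nonneg (div_nonneg hq0.le hr.le) hA.ne
  refine ⟨((∫⁻ u, (ENNReal.ofReal (Real.exp ((d / 2 - (2 * α + 2) / q) * u)) *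
    logKernel α d u) ^ r) ^ (q / r)).toNNReal, fun f hf => ?_⟩
  rw [ENNReal.coe_toNNReal hA'.ne]
  exact lintegral_mu_conv_rpow_le hp hpq hr hpqr hd hf

/-! ### Null sets, measurability and absolute convergence for complex functions. -/

/-- Translations of `μ_α`-almost everywhere equal functions are almost everywhere equal. -/
theorem ae_ae_comp_side {α : ℝ} {P : ℝ → Prop} (hP : ∀ᵐ y ∂(mu α), P y) (x : ℝ) :
    ∀ᵐ y ∂(mu α), ∀ᵐ θ ∂(nu α), P (side x y θ) := by
  obtain ⟨s, hs, hsm, hs0⟩ := exists_measurable_superset_of_null hP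
  have h : ∫⁻ y, ∫⁻ θ, s.indicator 1 (side x y θ) ∂(nu α) ∂(mu α) = 0 := by
    have hm : Measurable (s.indicator (1 : ℝ → ℝ≥0∞)) := measurable_one.indicator hsm
    -- After the swap the integral is `μ_α(s)` times the mass of `ν_α`, which vanishes even if that
    -- mass is infinite.
    rw [lintegral_mu_nu_swap α x (Φ := fun a _ => s.indicator 1 a) (hm.comp measurable_fst)]
    simp_rw [lintegral_const]
    rw [lintegral_mul_const _ hm, lintegral_indicator_one hsm, hs0, zero_mul]
  have hm : Measurable fun z : ℝ × ℝ => s.indicator (1 : ℝ → ℝ≥0∞) (side x z.1 z.2) :=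
    (measurable_one.indicator hsm).comp (measurable_side x)
  rw [lintegral_eq_zero_iff hm.lintegral_prod_right'] at h
  filter_upwards [h] with y hy
  rw [Pi.zero_apply, lintegral_eq_zero_iff (f := fun θ => s.indicator 1 (side x y θ))
    ((measurable_one.indicator hsm).comp (measurable_side_right x y))] at hy
  filter_upwards [hy] with θ hθ
  by_contra hn
  have : side x y θ ∈ s := hs hn
  simp [this] at hθ

theorem translation_congr_ae {α : ℝ} {F G : ℝ → ℂ} (h : F =ᵐ[mu α] G) (x : ℝ) :
    translation α x F =ᵐ[mu α] translation α x G := by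
  filter_upwards [ae_ae_comp_side h x] with y hy
  exact integral_congr_ae hy

theorem conv_congr_ae {α : ℝ} {F G : ℝ → ℂ} (h : F =ᵐ[mu α] G) (K : ℝ → ℂ) :
    conv α F K = conv α G K := by
  funext x
  refine integral_congr_ae ?_
  filter_upwards [translation_congr_ae h x] with y hy
  rw [hy]

theorem ConvExistsAt.congr_ae {α : ℝ} {F G : ℝ → ℂ} (h : F =ᵐ[mu α] G) {K : ℝ → ℂ} {x : ℝ}
    (hG : ConvExistsAt α G K x) : ConvExistsAt α F K x := by
  refine ⟨?_, hG.2.congr ?_⟩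
  · filter_upwards [hG.1, ae_ae_comp_side h x] with y hy hy'
    exact hy.congr (Filter.EventuallyEq.symm hy')
  · filter_upwards [translation_congr_ae h x] with y hy
    rw [hy]

theorem stronglyMeasurable_translation_uncurry (α : ℝ) {F : ℝ → ℂ} (hF : StronglyMeasurable F) :
    StronglyMeasurable fun z : ℝ × ℝ => translation α z.1 F z.2 :=
  (hF.comp_measurable measurable_side_uncurry).integral_prod_right'

theorem stronglyMeasurable_conv (α : ℝ) {F K : ℝ → ℂ} (hF : StronglyMeasurable F)
    (hK : StronglyMeasurable K) : StronglyMeasurable (conv α F K) :=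
  ((stronglyMeasurable_translation_uncurry α hF).mul
    (hK.comp_measurable measurable_snd)).integral_prod_right'

theorem enorm_translation_mul_le (α x y : ℝ) {F K : ℝ → ℂ} (hF : StronglyMeasurable F) :
    ‖translation α x F y * K y‖ₑ ≤ ∫⁻ θ, ‖F (side x y θ)‖ₑ * ‖K y‖ₑ ∂(nu α) := by
  rw [lintegral_mul_const (f := fun θ => ‖F (side x y θ)‖ₑ) _
    (hF.enorm.comp (measurable_side_right x y)),
    enorm_mul]
  exact mul_le_mul_left (enorm_integral_le_lintegral_enorm _) _

theorem enorm_conv_le (α x : ℝ) {F K : ℝ → ℂ} (hF : StronglyMeasurable F) :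
    ‖conv α F K x‖ₑ ≤ ∫⁻ y, ∫⁻ θ, ‖F (side x y θ)‖ₑ * ‖K y‖ₑ ∂(nu α) ∂(mu α) :=
  (enorm_integral_le_lintegral_enorm _).trans
    (lintegral_mono fun y => enorm_translation_mul_le α x y hF)

/-- Finiteness of the double integral controls the inner integral of `F` only where `K y ≠ 0`, since
`∞ * 0 = 0`. -/
theorem convExistsAt_of_lintegral_ne_top {α x : ℝ} {F K : ℝ → ℂ} (hF : StronglyMeasurable F)
    (hK : StronglyMeasurable K) (hK0 : ∀ᵐ y ∂(mu α), K y ≠ 0)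
    (h : ∫⁻ y, ∫⁻ θ, ‖F (side x y θ)‖ₑ * ‖K y‖ₑ ∂(nu α) ∂(mu α) ≠ ∞) : ConvExistsAt α F K x := by
  have hm : Measurable fun z : ℝ × ℝ => ‖F (side x z.1 z.2)‖ₑ * ‖K z.1‖ₑ :=
    (hF.enorm.comp (measurable_side x)).mul (hK.enorm.comp measurable_fst)
  refine ⟨?_, ?_, ?_⟩
  · filter_upwards [ae_lt_top hm.lintegral_prod_right' h, hK0] with y hy hKy
    refine ⟨(hF.comp_measurable (measurable_side_right x y)).aestronglyMeasurable, ?_⟩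
    rw [lintegral_mul_const (f := fun θ => ‖F (side x y θ)‖ₑ) _
    (hF.enorm.comp (measurable_side_right x y))] at hy
    exact lt_of_le_of_ne le_top fun htop => by
      rw [show ∫⁻ θ, ‖F (side x y θ)‖ₑ ∂(nu α) = ∞ from htop,
        ENNReal.top_mul (by simpa using hKy)] at hy
      exact hy.ne rfl
  · exact (((stronglyMeasurable_translation_uncurry α hF).comp_measurable
      measurable_prodMk_left).mul hK).aestronglyMeasurable
  · exact (lintegral_mono fun y => enorm_translation_mul_le α x y hF).trans_lt h.lt_top

theorem stronglyMeasurable_kernel (α σ : ℝ) : StronglyMeasurable (kernel α σ) := by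
  refine Measurable.stronglyMeasurable ?_
  unfold kernel
  fun_prop

end Hankel

/-! ### The main theorem. -/

theorem theorem2p2 (α p q σ : ℝ) (hα : -1 / 2 < α) (hp : 1 < p) (hpq : p < q)
    (hσ : 1 / q = 1 / p - σ / (α + 1)) :
    ∃ C : ℝ≥0, ∀ F : ℝ → ℂ, MemLp F (ENNReal.ofReal p) (Hankel.mu α) →
      (∀ᵐ x ∂(Hankel.mu α), Hankel.ConvExistsAt α F (Hankel.kernel α σ) x) ∧
      MemLp (Hankel.conv α F (Hankel.kernel α σ)) (ENNReal.ofReal q) (Hankel.mu α) ∧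
      eLpNorm (Hankel.conv α F (Hankel.kernel α σ)) (ENNReal.ofReal q) (Hankel.mu α) ≤
        C * eLpNorm F (ENNReal.ofReal p) (Hankel.mu α) := by
  have hp0 : 0 < p := by linarith
  have hq0 : 0 < q := by linarith
  have hα1 : 0 < α + 1 := by linarith
  have hinv : 0 < 1 - σ / (α + 1) := by
    have : 1 / p < 1 := by rw [div_lt_one hp0]; exact hp
    have : 0 < 1 / q := by positivity
    linarith
  -- The Young exponent: the relation defining `σ` becomes `1/p + 1/r = 1 + 1/q`.
  set r := (1 - σ / (α + 1))⁻¹ with hr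
  have hr1 : 1 / r = 1 - σ / (α + 1) := by rw [hr, one_div, inv_inv]
  set d := -(2 * (σ - α - 1)) with hd
  have hdr : d = (2 * α + 2) / r := by
    rw [div_eq_mul_one_div, hr1, hd]; field_simp; ring
  obtain ⟨C, hC⟩ := Hankel.exists_lintegral_mu_conv_rpow_le hα hp hpq (inv_pos.2 hinv)
    (by rw [hr1]; linarith) hdr
  refine ⟨C ^ (1 / q), fun F hF => ?_⟩
  -- A strongly measurable representative; replacing `F` by it leaves the convolution unchanged at
  -- every `x`.
  obtain ⟨G, hG, hFG⟩ := hF.1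
  have hGp : MemLp G (ENNReal.ofReal p) (Hankel.mu α) := (memLp_congr_ae hFG).1 hF
  have hKm := Hankel.stronglyMeasurable_kernel α σ
  have hKn : ∀ᵐ y ∂(Hankel.mu α), ‖Hankel.kernel α σ y‖ₑ = ENNReal.ofReal (y ^ (-d)) := by
    filter_upwards [Hankel.ae_mu_pos α] with y hy
    rw [Hankel.kernel, hd, neg_neg, ← ofReal_norm, Complex.norm_real,
      Real.norm_of_nonneg (by positivity)]
  have hK0 : ∀ᵐ y ∂(Hankel.mu α), Hankel.kernel α σ y ≠ 0 := by
    filter_upwards [Hankel.ae_mu_pos α] with y hy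
    rw [Hankel.kernel, Complex.ofReal_ne_zero]
    exact (Real.rpow_pos_of_pos hy _).ne'
  have hint : ∀ x, ∫⁻ y, ∫⁻ θ, ‖G (Hankel.side x y θ)‖ₑ * ‖Hankel.kernel α σ y‖ₑ
      ∂(Hankel.nu α) ∂(Hankel.mu α) = ∫⁻ y, ∫⁻ θ, ‖G (Hankel.side x y θ)‖ₑ *
      ENNReal.ofReal (y ^ (-d)) ∂(Hankel.nu α) ∂(Hankel.mu α) := fun x => by
    refine lintegral_congr_ae ?_
    filter_upwards [hKn] with y hy
    rw [hy]
  have hpne : ENNReal.ofReal p ≠ 0 := by simpa using hp0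
  have hqne : ENNReal.ofReal q ≠ 0 := by simpa using hq0
  have hbound := hC (fun y => ‖G y‖ₑ) hG.enorm
  simp_rw [← hint] at hbound
  set I := fun x => ∫⁻ y, ∫⁻ θ, ‖G (Hankel.side x y θ)‖ₑ * ‖Hankel.kernel α σ y‖ₑ
      ∂(Hankel.nu α) ∂(Hankel.mu α) with hI
  have hIm : Measurable I := by
    have h1 : Measurable fun z : (ℝ × ℝ) × ℝ =>
        ‖G (Hankel.side z.1.1 z.1.2 z.2)‖ₑ * ‖Hankel.kernel α σ z.1.2‖ₑ :=
      (hG.enorm.comp Hankel.measurable_side_uncurry).mul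
        (hKm.enorm.comp (measurable_snd.comp measurable_fst))
    exact h1.lintegral_prod_right'.lintegral_prod_right'
  have hGnorm : eLpNorm G (ENNReal.ofReal p) (Hankel.mu α) =
      (∫⁻ y, ‖G y‖ₑ ^ p ∂(Hankel.mu α)) ^ (1 / p) := by
    rw [eLpNorm_eq_lintegral_rpow_enorm_toReal hpne ENNReal.ofReal_ne_top,
      ENNReal.toReal_ofReal hp0.le]
  have hGfin : ∫⁻ y, ‖G y‖ₑ ^ p ∂(Hankel.mu α) < ∞ := by
    have := lintegral_rpow_enorm_lt_top_of_eLpNorm_lt_top hpne ENNReal.ofReal_ne_top hGp.2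
    rwa [ENNReal.toReal_ofReal hp0.le] at this
  have hle : eLpNorm (Hankel.conv α F (Hankel.kernel α σ)) (ENNReal.ofReal q) (Hankel.mu α) ≤
      (C ^ (1 / q) : ℝ≥0) * eLpNorm F (ENNReal.ofReal p) (Hankel.mu α) := by
    rw [Hankel.conv_congr_ae hFG, eLpNorm_congr_ae hFG, hGnorm,
      eLpNorm_eq_lintegral_rpow_enorm_toReal hqne ENNReal.ofReal_ne_top,
      ENNReal.toReal_ofReal hq0.le]
    calc _ ≤ (∫⁻ x, I x ^ q ∂(Hankel.mu α)) ^ (1 / q) := by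
          gcongr with x
          exact Hankel.enorm_conv_le α x hG
      _ ≤ (C * (∫⁻ y, ‖G y‖ₑ ^ p ∂(Hankel.mu α)) ^ (q / p)) ^ (1 / q) := by gcongr
      _ = _ := by
          rw [ENNReal.mul_rpow_of_nonneg _ _ (by positivity), ← ENNReal.rpow_mul,
            ENNReal.coe_rpow_of_nonneg _ (by positivity)]
          congr 2
          field_simp
  refine ⟨?_, ⟨?_, ?_⟩, hle⟩
  · have hfin : ∫⁻ x, I x ^ q ∂(Hankel.mu α) ≠ ∞ :=
      (hbound.trans_lt (ENNReal.mul_lt_top ENNReal.coe_lt_top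
        (ENNReal.rpow_lt_top_of_nonneg (by positivity) hGfin.ne))).ne
    filter_upwards [ae_lt_top (hIm.pow_const q) hfin] with x hx
    refine (Hankel.convExistsAt_of_lintegral_ne_top hG hKm hK0 ?_).congr_ae hFG
    exact (ENNReal.rpow_lt_top_iff_of_pos hq0).1 hx |>.ne
  · rw [Hankel.conv_congr_ae hFG]
    exact (Hankel.stronglyMeasurable_conv α hG hKm).aestronglyMeasurable
  · exact hle.trans_lt (ENNReal.mul_lt_top ENNReal.coe_lt_top hF.2)
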